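/- **Theorem 3.1.** For a field $K\subseteq\mathbb C$ and a binary form $f\in K[x,y]$ of degree $d$, the $K$-rank $L_K(f)$ is the smallest $r$ for which there are $\lambda_j,\alpha_j,\beta_j\in K$ $(1\le j\le r)$ with $$f(x,y)=\sum_{j=1}^r\lambda_j(\alpha_jx+\beta_jy)^d .$$ For every $d\ge5$ there is a binary form $p\in\mathbb C[x,y]$ of degree $d$ that has at least three different relative ranks; that is, the set of the values $L_K(p)$, where $K$ runs over the subfields of $\mathbb C$ that contain the coefficients of $p$, has at least three elements. Explicitly, let $k\ge3$, and for $m\geq 1$ let $\zeta_m\in\mathbb C$ denote a primitive $m$-th root of unity. The form $p_{2k-1}=x^{k-1}y^{k-1}(x-y)$, of degree $2k-1$, satisfies $$L_{\mathbb Q(\zeta_{k+1})}(p_{2k-1})=k,\qquad L_{\mathbb Q(\zeta_k)}(p_{2k-1})=k+1,\qquad L_{\mathbb R}(p_{2k-1})=2k-1,$$ and the form $p_{2k}=x^ky^k$, of degree $2k$, satisfies $$L_{\mathbb Q(\zeta_{k+1})}(p_{2k})=k+1,\qquad L_{\mathbb Q(\zeta_k)}(p_{2k})=k+2,\qquad L_{\mathbb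 R}(p_{2k})=2k .$$ -/

import Mathlib

open MvPolynomial
open scoped IntermediateField

/-- The form `f` of degree `d` (in the variables `x = X 0`, `y = X 1`) is a `K`-linear combination
of the `d`-th powers of `r` linear forms with coefficients in the field `K ⊆ ℂ`. -/
def HasPowerRep (K : Subfield ℂ) (d : ℕ) (f : MvPolynomial (Fin 2) ℂ) (r : ℕ) : Prop :=
  ∃ lam a b : Fin r → K,
    f = ∑ j, C (lam j : ℂ) * (C (a j : ℂ) * X 0 + C (b j : ℂ) * X 1) ^ d

/-- `r` is the `K`-rank (`K`-length) `L_K(f)` of the form `f` of degree `d`: it is the smallest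
number of summands in a representation of `f` as a `K`-linear combination of `d`-th powers of
linear forms over `K` (in particular such a representation exists). -/
def IsRelRank (K : Subfield ℂ) (d : ℕ) (f : MvPolynomial (Fin 2) ℂ) (r : ℕ) : Prop :=
  IsLeast {s : ℕ | HasPowerRep K d f s} r

/-- The set of all relative ranks of the form `f` of degree `d`, taken over all the fields
`K ⊆ ℂ` that contain the coefficients of `f`. -/
def relRanks (d : ℕ) (f : MvPolynomial (Fin 2) ℂ) : Set ℕ :=
  {r | ∃ K : Subfield ℂ, (∀ m, f.coeff m ∈ K) ∧ IsRelRank K d f r}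

/-- The field of real numbers as a subfield of `ℂ`. -/
noncomputable def realSubfield : Subfield ℂ := Complex.ofRealHom.fieldRange

/-- The form `x^(k-1) y^(k-1) (x - y)`, of degree `2k - 1` for `k ≥ 1`. -/
noncomputable def oddForm (k : ℕ) : MvPolynomial (Fin 2) ℂ :=
  X 0 ^ (k - 1) * X 1 ^ (k - 1) * (X 0 - X 1)

/-- The form `x^k y^k`, of degree `2k`. -/
noncomputable def evenForm (k : ℕ) : MvPolynomial (Fin 2) ℂ :=
  X 0 ^ k * X 1 ^ k

/-! Lower bounds. A representation by s powers yields a monic polynomial h with distinct roots in K,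
the nodes b_j/a_j, whose coefficients annihilate shifts of the normalized coefficients of the form
(Sylvester, `HasPowerRep.exists_apolar`). The two forms have only one or two nonzero coefficients,
in the middle, so middle coefficients of h must vanish (even form) or coincide (odd form). At the
least possible number of nodes h is X^(k+1) + c or 1 + X + ... + X^k, and roots in K then force
ζ_(k+1) ∈ K (`mem_of_hasPowerRep_evenForm`, `mem_of_hasPowerRep_oddForm`), which a degree count
excludes for ℚ(ζ_k). Over ℝ, Newton's inequalities (`newton_ineq_of_distinct_roots`) forbid two
consecutive zeros or three equal consecutive coefficients, so fewer powers than the degree do not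
suffice.

Upper bounds. Sums over roots of unity (`IsPrimitiveRoot.sum_pow_mul`) isolate residue classes of
exponents; for ζ_k the terms x^d and y^d survive as well and cost two more powers. With d nodes in
degree d, Sylvester's condition is a single equation, solved by a palindromic polynomial with
rational roots (`exists_weights_of_apolar`, `coeff_prod_symmetricNodes`). -/

/-! ### Binary forms by coefficients; power representations -/

/-- The binary form of degree `d` whose coefficient of `x^(d-i) y^i` is `F i`. -/
noncomputable def binaryForm (d : ℕ) (F : ℕ → ℂ) : MvPolynomial (Fin 2) ℂ :=
  ∑ i ∈ Finset.range (d + 1), C (F i) * (X 0 ^ (d - i) * X 1 ^ i)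

theorem binaryForm_congr {d : ℕ} {F G : ℕ → ℂ} (h : ∀ i ≤ d, F i = G i) :
    binaryForm d F = binaryForm d G := by
  refine Finset.sum_congr rfl fun i hi => ?_
  rw [h i (by simpa [Nat.lt_succ_iff] using hi)]

theorem binaryForm_add (d : ℕ) (F G : ℕ → ℂ) :
    binaryForm d F + binaryForm d G = binaryForm d (fun i => F i + G i) := by
  simp only [binaryForm, ← Finset.sum_add_distrib, C_add, add_mul]

theorem binaryForm_single {d i : ℕ} (hi : i ≤ d) (c : ℂ) :
    binaryForm d (fun j => if j = i then c else 0) = C c * (X 0 ^ (d - i) * X 1 ^ i) := by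
  rw [binaryForm, Finset.sum_eq_single i]
  · simp
  · intro j _ hj
    simp [hj]
  · intro h
    exact absurd (Finset.mem_range.2 (Nat.lt_succ_of_le hi)) h

theorem eq_of_binaryForm_eq {d : ℕ} {F G : ℕ → ℂ} (h : binaryForm d F = binaryForm d G)
    {i : ℕ} (hi : i ≤ d) : F i = G i := by
  have key : ∀ H : ℕ → ℂ,
      (aeval ![(1 : Polynomial ℂ), Polynomial.X] (binaryForm d H)).coeff i = H i := by
    intro H
    simp only [binaryForm, map_sum, map_mul, map_pow, aeval_X, Polynomial.finsetSum_coeff]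
    simp [← MvPolynomial.algebraMap_eq, Polynomial.coeff_X_pow]
    omega
  rw [← key F, h, key G]

theorem sum_pow_eq_binaryForm {ι : Type*} (s : Finset ι) (lam a b : ι → ℂ) (d : ℕ) :
    ∑ j ∈ s, C (lam j) * (C (a j) * X 0 + C (b j) * X 1) ^ d =
      binaryForm d (fun i => d.choose i * ∑ j ∈ s, lam j * a j ^ (d - i) * b j ^ i) := by
  simp only [binaryForm, add_comm (C (a _) * X (R := ℂ) (0 : Fin 2)), add_pow, mul_pow, Finset.mul_sum, map_sum,
    Finset.sum_mul]
  rw [Finset.sum_comm]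
  refine Finset.sum_congr rfl fun i _ => Finset.sum_congr rfl fun j _ => ?_
  simp only [map_mul, map_pow, map_natCast]
  ring

theorem hasPowerRep_of_finset {K : Subfield ℂ} {d : ℕ} {F : ℕ → ℂ} {ι : Type*} (s : Finset ι)
    (lam a b : ι → ℂ) (hlam : ∀ j, lam j ∈ K) (ha : ∀ j, a j ∈ K) (hb : ∀ j, b j ∈ K)
    (h : ∀ i ≤ d, F i = d.choose i * ∑ j ∈ s, lam j * a j ^ (d - i) * b j ^ i) :
    HasPowerRep K d (binaryForm d F) s.card := by
  refine ⟨fun j => ⟨lam (s.equivFin.symm j), hlam _⟩, fun j => ⟨a (s.equivFin.symm j), ha _⟩,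
    fun j => ⟨b (s.equivFin.symm j), hb _⟩, ?_⟩
  rw [binaryForm_congr h, ← sum_pow_eq_binaryForm, ← Finset.sum_coe_sort]
  exact (Equiv.sum_comp s.equivFin.symm
    (fun j : s => C (lam j) * (C (a j) * X 0 + C (b j) * X 1) ^ d)).symm

theorem HasPowerRep.add_pow {K : Subfield ℂ} {d : ℕ} {f : MvPolynomial (Fin 2) ℂ} {r : ℕ}
    (h : HasPowerRep K d f r) {c a b : ℂ} (hc : c ∈ K) (ha : a ∈ K) (hb : b ∈ K) :
    HasPowerRep K d (f + C c * (C a * X 0 + C b * X 1) ^ d) (r + 1) := by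
  obtain ⟨lam, A, B, rfl⟩ := h
  refine ⟨Fin.cons ⟨c, hc⟩ lam, Fin.cons ⟨a, ha⟩ A, Fin.cons ⟨b, hb⟩ B, ?_⟩
  rw [Fin.sum_univ_succ, add_comm]
  simp

theorem HasPowerRep.mono {K : Subfield ℂ} {d : ℕ} {f : MvPolynomial (Fin 2) ℂ} {r s : ℕ}
    (h : HasPowerRep K d f r) (hrs : r ≤ s) : HasPowerRep K d f s := by
  induction s, hrs using Nat.le_induction with
  | base => exact h
  | succ s _ ih => simpa using ih.add_pow K.zero_mem K.zero_mem K.zero_mem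

/-- Zero summands may be added, so minimality needs checking only one step below. -/
theorem isRelRank_of_not {K : Subfield ℂ} {d : ℕ} {f : MvPolynomial (Fin 2) ℂ} {r : ℕ}
    (h : HasPowerRep K d f (r + 1)) (hn : ¬ HasPowerRep K d f r) : IsRelRank K d f (r + 1) :=
  ⟨h, fun s hs => by
    by_contra hlt
    exact hn (HasPowerRep.mono hs (by omega))⟩

/-! ### Apolarity -/

/-- Sylvester's criterion, necessity: the form with normalized coefficients `a i` is apolar to the
product of the linear forms that vanish at the (finite) nodes of a power representation. -/
theorem HasPowerRep.exists_apolar {K : Subfield ℂ} {d s : ℕ} {a : ℕ → ℂ}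
    (h : HasPowerRep K d (binaryForm d (fun i => d.choose i * a i)) s) :
    ∃ T : Finset ℂ, (∀ t ∈ T, t ∈ K) ∧ T.card ≤ s ∧ ∀ l, (l + s ≤ d ∨ l + T.card < d) →
      ∑ i ∈ Finset.range (T.card + 1),
        (∏ t ∈ T, (Polynomial.X - Polynomial.C t)).coeff i * a (i + l) = 0 := by
  classical
  obtain ⟨lam, A, B, hf⟩ := h
  have ha : ∀ i ≤ d, a i = ∑ j, (lam j : ℂ) * (A j : ℂ) ^ (d - i) * (B j : ℂ) ^ i := by
    intro i hi
    have h1 := sum_pow_eq_binaryForm Finset.univ (fun j => (lam j : ℂ)) (fun j => (A j : ℂ))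
      (fun j => (B j : ℂ)) d
    have h2 := eq_of_binaryForm_eq (hf.trans h1) hi
    exact mul_left_cancel₀ (Nat.cast_ne_zero.2 (Nat.choose_pos hi).ne') h2
  -- Summands with `A j = 0`, powers of y alone, have no finite node; repeated nodes merge in `T`.
  set J := Finset.univ.filter (fun j => A j ≠ 0) with hJ
  set T := J.image (fun j => (B j / A j : ℂ)) with hT
  have hTs : T.card ≤ s := Finset.card_image_le.trans ((Finset.card_le_univ _).trans (by simp))
  refine ⟨T, ?_, hTs, ?_⟩
  · intro t ht
    obtain ⟨j, -, rfl⟩ := Finset.mem_image.1 ht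
    exact K.div_mem (B j).2 (A j).2
  intro l hl
  set h : Polynomial ℂ := ∏ t ∈ T, (Polynomial.X - Polynomial.C t) with hh
  have hdeg : h.natDegree = T.card := by simp [hh]
  have hle : ∀ i ∈ Finset.range (T.card + 1), i + l ≤ d := by
    intro i hi
    have := Finset.mem_range.1 hi
    omega
  rw [Finset.sum_congr rfl fun i hi => by rw [ha _ (hle i hi), Finset.mul_sum], Finset.sum_comm]
  refine Finset.sum_eq_zero fun j _ => ?_
  by_cases hA : A j = 0
  -- A power of y contributes to `a d` only. Its presence makes `T.card < s`, so under either
  -- alternative on `l` the index `i + l` stays below `d`.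
  · have hlt : T.card < s := by
      refine Finset.card_image_le.trans_lt ?_
      have : J.card < (Finset.univ : Finset (Fin s)).card :=
        Finset.card_lt_card ⟨Finset.subset_univ _, fun hsub => by
          have := hsub (Finset.mem_univ j)
          simp [hJ, hA] at this⟩
      simpa using this
    refine Finset.sum_eq_zero fun i hi => ?_
    have := Finset.mem_range.1 hi
    rw [hA, ZeroMemClass.coe_zero, zero_pow (by omega)]
    ring
  · have hA' : (A j : ℂ) ≠ 0 := by simpa using hA
    have hroot : h.eval (B j / A j : ℂ) = 0 := by
      rw [hh, Polynomial.eval_prod]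
      refine Finset.prod_eq_zero (i := (B j / A j : ℂ)) ?_ (by simp)
      exact Finset.mem_image.2 ⟨j, by simp [hJ, hA], rfl⟩
    rw [Polynomial.eval_eq_sum_range, hdeg] at hroot
    rw [← mul_zero ((lam j : ℂ) * A j ^ d * (B j / A j) ^ l), ← hroot, Finset.mul_sum]
    refine Finset.sum_congr rfl fun i hi => ?_
    obtain ⟨m, hm⟩ := Nat.exists_eq_add_of_le (hle i hi)
    rw [show d - (i + l) = m by omega, hm, div_pow, div_pow]
    field_simp
    ring

theorem evenForm_eq (k : ℕ) :
    evenForm k = binaryForm (2 * k) (fun i => if i = k then 1 else 0) := by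
  rw [binaryForm_single (by omega), evenForm]
  simp [show 2 * k - k = k by omega]

theorem oddForm_eq {k : ℕ} (hk : 1 ≤ k) :
    oddForm k = binaryForm (2 * k - 1)
      (fun i => (if i = k - 1 then 1 else 0) + (if i = k then -1 else 0)) := by
  rw [← binaryForm_add, binaryForm_single (by omega), binaryForm_single (by omega), oddForm]
  obtain ⟨n, rfl⟩ := Nat.exists_eq_add_of_le' hk
  rw [show 2 * (n + 1) - 1 - (n + 1 - 1) = n + 1 by omega,
    show 2 * (n + 1) - 1 - (n + 1) = n by omega]
  simp only [Nat.add_sub_cancel, map_neg, map_one]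
  ring

theorem choose_mul_inv_mul {d k : ℕ} (hk : k ≤ d) (i : ℕ) (c : ℂ) :
    (d.choose i : ℂ) * (if i = k then c / d.choose k else 0) = if i = k then c else 0 := by
  split_ifs with h
  · subst h
    have : (d.choose i : ℂ) ≠ 0 := Nat.cast_ne_zero.2 (Nat.choose_pos hk).ne'
    field_simp
  · simp

theorem evenForm_eq_choose_mul (k : ℕ) :
    evenForm k = binaryForm (2 * k) (fun i => ((2 * k).choose i : ℂ) *
      (if i = k then 1 / ((2 * k).choose k : ℂ) else 0)) := by
  rw [evenForm_eq]
  exact binaryForm_congr fun i _ => (choose_mul_inv_mul (by omega) i 1).symm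

theorem choose_pred_eq {k : ℕ} (hk : 1 ≤ k) :
    (2 * k - 1).choose (k - 1) = (2 * k - 1).choose k :=
  Nat.choose_symm_of_eq_add (by omega)

theorem oddForm_eq_choose_mul {k : ℕ} (hk : 1 ≤ k) :
    oddForm k = binaryForm (2 * k - 1) (fun i => ((2 * k - 1).choose i : ℂ) *
      ((if i = k - 1 then 1 / ((2 * k - 1).choose k : ℂ) else 0) +
        (if i = k then -1 / ((2 * k - 1).choose k : ℂ) else 0))) := by
  rw [oddForm_eq hk]
  refine binaryForm_congr fun i _ => ?_
  rw [mul_add, choose_mul_inv_mul (by omega), ← choose_pred_eq hk, choose_mul_inv_mul (by omega)]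

/-- The apolarity equations for a power representation of `x^k y^k`. -/
theorem exists_nodes_of_evenForm {K : Subfield ℂ} {k s : ℕ}
    (h : HasPowerRep K (2 * k) (evenForm k) s) :
    ∃ T : Finset ℂ, (∀ t ∈ T, t ∈ K) ∧ T.card ≤ s ∧
      ∀ m ≤ k, (k + s ≤ 2 * k + m ∨ k + T.card < 2 * k + m) →
        (∏ t ∈ T, (Polynomial.X - Polynomial.C t)).coeff m = 0 := by
  rw [evenForm_eq_choose_mul] at h
  obtain ⟨T, hTK, hTs, hT⟩ := h.exists_apolar
  refine ⟨T, hTK, hTs, fun m hm hmk => ?_⟩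
  by_cases hmT : T.card < m
  · exact Polynomial.coeff_eq_zero_of_natDegree_lt (by simpa using hmT)
  -- The shift that moves position `m` onto the only nonzero coefficient.
  have h1 := hT (k - m) (by omega)
  rw [Finset.sum_eq_single m] at h1
  · have : ((2 * k).choose k : ℂ) ≠ 0 := Nat.cast_ne_zero.2 (Nat.choose_pos (by omega)).ne'
    simpa [show m + (k - m) = k by omega, this] using h1
  · intro i _ hi
    rw [if_neg (by omega), mul_zero]
  · intro hm'
    exact absurd (Finset.mem_range.2 (by omega)) hm'

/-- The apolarity equations for a power representation of `x^(k-1) y^(k-1) (x - y)`. -/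
theorem exists_nodes_of_oddForm {K : Subfield ℂ} {k s : ℕ}
    (h : HasPowerRep K (2 * k - 1) (oddForm k) s) :
    ∃ T : Finset ℂ, (∀ t ∈ T, t ∈ K) ∧ T.card ≤ s ∧
      ∀ m < k, (s ≤ k + m ∨ T.card < k + m) →
        (∏ t ∈ T, (Polynomial.X - Polynomial.C t)).coeff m =
          (∏ t ∈ T, (Polynomial.X - Polynomial.C t)).coeff (m + 1) := by
  by_cases hk : 1 ≤ k
  swap
  · exact ⟨∅, by simp, by simp, fun m hm => absurd hm (by omega)⟩
  rw [oddForm_eq_choose_mul hk] at h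
  obtain ⟨T, hTK, hTs, hT⟩ := h.exists_apolar
  refine ⟨T, hTK, hTs, fun m hm hmk => ?_⟩
  have h1 := hT (k - 1 - m) (by omega)
  set g : Polynomial ℂ := ∏ t ∈ T, (Polynomial.X - Polynomial.C t) with hg
  have hgd : g.natDegree = T.card := by simp [hg]
  have hc : ((2 * k - 1).choose k : ℂ) ≠ 0 := Nat.cast_ne_zero.2 (Nat.choose_pos (by omega)).ne'
  have hsum : ∀ (j : ℕ) (c : ℂ),
      ∑ i ∈ Finset.range (T.card + 1), g.coeff i * (if i = j then c else 0) = g.coeff j * c := by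
    intro j c
    rw [Finset.sum_eq_single j]
    · simp
    · intro i _ hi
      simp [hi]
    · intro hj
      rw [Polynomial.coeff_eq_zero_of_natDegree_lt]
      · simp
      · simp at hj
        omega
  simp only [mul_add, Finset.sum_add_distrib, show ∀ i, (i + (k - 1 - m) = k - 1) = (i = m) from
    fun i => propext (by omega), show ∀ i, (i + (k - 1 - m) = k) = (i = m + 1) from
    fun i => propext (by omega), hsum] at h1
  field_simp at h1
  linear_combination h1

/-! ### Lower bounds from the shape of the node polynomial -/

theorem prod_X_sub_C_coeff_card (T : Finset ℂ) :
    (∏ t ∈ T, (Polynomial.X - Polynomial.C t)).coeff T.card = 1 := by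
  have h : (∏ t ∈ T, (Polynomial.X - Polynomial.C t)).Monic :=
    Polynomial.monic_prod_of_monic _ _ fun t _ => Polynomial.monic_X_sub_C t
  simpa using h.coeff_natDegree

theorem prod_X_sub_C_coeff_succ_card (T : Finset ℂ) :
    (∏ t ∈ T, (Polynomial.X - Polynomial.C t)).coeff (T.card + 1) = 0 :=
  Polynomial.coeff_eq_zero_of_natDegree_lt (by simp)

theorem eval_prod_X_sub_C_eq_zero_iff (T : Finset ℂ) (z : ℂ) :
    (∏ t ∈ T, (Polynomial.X - Polynomial.C t)).eval z = 0 ↔ z ∈ T := by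
  simp [Polynomial.eval_prod, Finset.prod_eq_zero_iff, sub_eq_zero]

theorem not_hasPowerRep_evenForm_self {K : Subfield ℂ} {k : ℕ} :
    ¬ HasPowerRep K (2 * k) (evenForm k) k := by
  intro h
  obtain ⟨T, hTK, hTs, hT⟩ := exists_nodes_of_evenForm h
  have := prod_X_sub_C_coeff_card T
  rw [hT _ hTs (by omega)] at this
  exact zero_ne_one this

theorem mem_of_hasPowerRep_evenForm {K : Subfield ℂ} {k : ℕ} (hk : 1 ≤ k) {ζ : ℂ}
    (hζ : ζ ^ (k + 1) = 1) (h : HasPowerRep K (2 * k) (evenForm k) (k + 1)) : ζ ∈ K := by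
  obtain ⟨T, hTK, hTs, hT⟩ := exists_nodes_of_evenForm h
  have h1 := prod_X_sub_C_coeff_card T
  have hcard : T.card = k + 1 := by
    by_contra hne
    rw [hT _ (by omega) (by omega)] at h1
    exact zero_ne_one h1
  have heval : ∀ z : ℂ, (∏ t ∈ T, (Polynomial.X - Polynomial.C t)).eval z =
      (∏ t ∈ T, (Polynomial.X - Polynomial.C t)).coeff 0 + z ^ (k + 1) := by
    intro z
    rw [Polynomial.eval_eq_sum_range' (n := k + 2) (by simp [hcard]), Finset.sum_range_succ,
      Finset.sum_range_succ', Finset.sum_eq_zero, ← hcard, h1]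
    · simp
    · intro i hi
      rw [hT _ (by have := Finset.mem_range.1 hi; omega) (by omega), zero_mul]
  -- The node polynomial is X^(k+1) + c, so its root set is stable under multiplication by ζ, and ζ
  -- is a quotient of two roots.
  obtain ⟨t, htT, ht0⟩ := Finset.exists_mem_ne (show 1 < T.card by omega) 0
  have h2 : ζ * t ∈ T := by
    rw [← eval_prod_X_sub_C_eq_zero_iff, heval, mul_pow, hζ, one_mul, ← heval,
      eval_prod_X_sub_C_eq_zero_iff]
    exact htT
  have := K.div_mem (hTK _ h2) (hTK _ htT)
  rwa [mul_div_cancel_right₀ _ ht0] at this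

/-- Otherwise the leading coefficient 1 would equal the coefficient 0 just above it. -/
theorem card_ge_of_oddForm_nodes {k s : ℕ} {T : Finset ℂ}
    (hT : ∀ m < k, (s ≤ k + m ∨ T.card < k + m) →
        (∏ t ∈ T, (Polynomial.X - Polynomial.C t)).coeff m =
          (∏ t ∈ T, (Polynomial.X - Polynomial.C t)).coeff (m + 1)) : k ≤ T.card := by
  by_contra! hlt
  by_cases hk : T.card < k + T.card
  · have := hT _ hlt (Or.inr hk)
    rw [prod_X_sub_C_coeff_card, prod_X_sub_C_coeff_succ_card] at this
    exact one_ne_zero this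
  · omega

theorem not_hasPowerRep_oddForm_pred {K : Subfield ℂ} {k : ℕ} (hk : 1 ≤ k) :
    ¬ HasPowerRep K (2 * k - 1) (oddForm k) (k - 1) := by
  intro h
  obtain ⟨T, hTK, hTs, hT⟩ := exists_nodes_of_oddForm h
  exact (Nat.sub_one_lt_of_le hk le_rfl).not_ge ((card_ge_of_oddForm_nodes hT).trans hTs)

theorem mem_of_hasPowerRep_oddForm {K : Subfield ℂ} {k : ℕ} {ζ : ℂ}
    (hζ : ζ ^ (k + 1) = 1) (h : HasPowerRep K (2 * k - 1) (oddForm k) k) : ζ ∈ K := by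
  by_cases hζ1 : ζ = 1
  · exact hζ1 ▸ K.one_mem
  obtain ⟨T, hTK, hTs, hT⟩ := exists_nodes_of_oddForm h
  have hcard : T.card = k := le_antisymm hTs (card_ge_of_oddForm_nodes hT)
  -- The equalities descend from the leading coefficient: the polynomial is 1 + X + ... + X^k, whose
  -- roots are the (k+1)-th roots of unity other than 1.
  have hcoeff : ∀ m ≤ k, (∏ t ∈ T, (Polynomial.X - Polynomial.C t)).coeff m = 1 := by
    intro m hm
    induction hm using Nat.decreasingInduction with
    | self =>
      have := prod_X_sub_C_coeff_card T
      rwa [hcard] at this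
    | of_succ m hm ih => rw [hT m hm (by omega), ih]
  refine hTK _ ((eval_prod_X_sub_C_eq_zero_iff T ζ).1 ?_)
  rw [Polynomial.eval_eq_sum_range' (n := k + 1) (by simp [hcard]),
    Finset.sum_congr rfl fun i hi => by
      rw [hcoeff i (Nat.lt_succ_iff.1 (Finset.mem_range.1 hi)), one_mul]]
  have := mul_geom_sum ζ (k + 1)
  rw [hζ, sub_self] at this
  exact (mul_eq_zero.1 this).resolve_left (sub_ne_zero.2 hζ1)

/-! ### Roots of unity in cyclotomic fields -/

theorem finrank_adjoin_primitiveRoot {n : ℕ} (hn : 0 < n) {ξ : ℂ} (hξ : IsPrimitiveRoot ξ n) :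
    Module.finrank ℚ ℚ⟮ξ⟯ = n.totient := by
  rw [IntermediateField.adjoin.finrank ((hξ.isIntegral hn).tower_top),
    ← Polynomial.cyclotomic_eq_minpoly_rat hξ hn, Polynomial.natDegree_cyclotomic]

/-- Otherwise ζξ, of order mn, lies in ℚ(ξ); comparing degrees, φ(m)φ(n) ≤ φ(n), so φ(m) ≤ 1 and m ∣
2. -/
theorem primitiveRoot_notMem_adjoin {m n : ℕ} (hm : 2 < m) (hn : 0 < n) (hmn : m.Coprime n)
    {ζ ξ : ℂ} (hζ : IsPrimitiveRoot ζ m) (hξ : IsPrimitiveRoot ξ n) : ζ ∉ ℚ⟮ξ⟯ := by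
  intro hmem
  have hprim : IsPrimitiveRoot (ζ * ξ) (m * n) := by
    rw [IsPrimitiveRoot.iff_orderOf, (Commute.all ζ ξ).orderOf_mul_eq_mul_orderOf_of_coprime,
      ← hζ.eq_orderOf, ← hξ.eq_orderOf]
    rwa [← hζ.eq_orderOf, ← hξ.eq_orderOf]
  have hint : IsIntegral ℚ ξ := (hξ.isIntegral hn).tower_top
  have : FiniteDimensional ℚ ℚ⟮ξ⟯ := IntermediateField.adjoin.finiteDimensional hint
  have hsub : ℚ⟮ζ * ξ⟯ ≤ ℚ⟮ξ⟯ :=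
    IntermediateField.adjoin_simple_le_iff.2
      (mul_mem hmem (IntermediateField.mem_adjoin_simple_self ℚ ξ))
  have hle : Module.finrank ℚ ℚ⟮ζ * ξ⟯ ≤ Module.finrank ℚ ℚ⟮ξ⟯ :=
    Submodule.finrank_mono (s := ℚ⟮ζ * ξ⟯.toSubalgebra.toSubmodule)
      (t := ℚ⟮ξ⟯.toSubalgebra.toSubmodule) hsub
  rw [finrank_adjoin_primitiveRoot (Nat.mul_pos (by omega) hn) hprim,
    finrank_adjoin_primitiveRoot hn hξ, Nat.totient_mul hmn] at hle
  have h1 : 0 < n.totient := Nat.totient_pos.2 hn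
  have h2 : m.totient ≤ 1 := by
    by_contra! h
    nlinarith
  have h3 := Nat.le_of_dvd two_pos (Nat.dvd_two_of_totient_le_one (by omega) h2)
  omega

/-! ### Real lower bounds: Laguerre and Newton inequalities -/

/-- Induction on the roots: a factor X - a turns the expression L(q) into q² + (x - a)² L(q).
Distinctness keeps q and x - a from vanishing together, hence the strict sign. -/
theorem laguerre_pos {ι : Type*} (s : Finset ι) (v : ι → ℝ) (hv : Set.InjOn v s)
    (hs : s.Nonempty) (x : ℝ) :
    0 < (∏ i ∈ s, (Polynomial.X - Polynomial.C (v i))).derivative.eval x ^ 2 -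
      (∏ i ∈ s, (Polynomial.X - Polynomial.C (v i))).eval x *
        (∏ i ∈ s, (Polynomial.X - Polynomial.C (v i))).derivative.derivative.eval x := by
  classical
  induction hs using Finset.Nonempty.cons_induction with
  | singleton a => simp
  | cons a s ha hs ih =>
    have ih' := ih (hv.mono (by simp))
    rw [Finset.prod_cons]
    have hroot : (∏ i ∈ s, (Polynomial.X - Polynomial.C (v i))).eval x = 0 → x ≠ v a := by
      rw [Polynomial.eval_prod, Finset.prod_eq_zero_iff]
      rintro ⟨i, hi, hix⟩ rfl
      have : v a = v i := by simpa [sub_eq_zero] using hix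
      exact ha (hv (by simp) (by simp [hi]) this ▸ hi)
    set q : Polynomial ℝ := ∏ i ∈ s, (Polynomial.X - Polynomial.C (v i))
    have hid : ((Polynomial.X - Polynomial.C (v a)) * q).derivative.eval x ^ 2 -
        ((Polynomial.X - Polynomial.C (v a)) * q).eval x *
          ((Polynomial.X - Polynomial.C (v a)) * q).derivative.derivative.eval x =
        q.eval x ^ 2 + (x - v a) ^ 2 *
          (q.derivative.eval x ^ 2 - q.eval x * q.derivative.derivative.eval x) := by
      simp
      ring
    rw [hid]
    by_cases hq : q.eval x = 0
    · have := sub_ne_zero.2 (hroot hq)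
      positivity
    · have := mul_nonneg (sq_nonneg (x - v a)) ih'.le
      positivity

theorem laguerre_pos_of_card_roots {g : Polynomial ℝ} (hg : 0 < g.natDegree)
    (hroots : g.natDegree ≤ g.roots.toFinset.card) (x : ℝ) :
    0 < g.derivative.eval x ^ 2 - g.eval x * g.derivative.derivative.eval x := by
  have hcard : g.roots.card = g.natDegree :=
    le_antisymm g.card_roots' (hroots.trans (Multiset.toFinset_card_le _))
  have hnd : g.roots.Nodup := by
    rw [← Multiset.dedup_card_eq_card_iff_nodup]
    exact le_antisymm (Multiset.card_le_card (Multiset.dedup_le _)) (hcard ▸ hroots)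
  have hprod := Polynomial.C_leadingCoeff_mul_prod_multiset_X_sub_C hcard
  have hfin : (g.roots.map fun a => Polynomial.X - Polynomial.C a).prod =
      ∏ t ∈ g.roots.toFinset, (Polynomial.X - Polynomial.C t) := by
    rw [Finset.prod, Multiset.toFinset_val, hnd.dedup]
  rw [hfin] at hprod
  have hpos := laguerre_pos g.roots.toFinset id (fun _ _ _ _ h => h)
    (Finset.card_pos.1 (hg.trans_le hroots)) x
  simp only [id] at hpos
  have hlc : g.leadingCoeff ≠ 0 := by
    rw [Polynomial.leadingCoeff_ne_zero]
    rintro rfl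
    simp at hg
  rw [← hprod]
  set q : Polynomial ℝ := ∏ t ∈ g.roots.toFinset, (Polynomial.X - Polynomial.C t)
  simp only [Polynomial.derivative_C_mul, Polynomial.eval_mul, Polynomial.eval_C]
  have : 0 < g.leadingCoeff ^ 2 := by positivity
  nlinarith [mul_pos this hpos]

theorem card_roots_iterate_derivative (p : Polynomial ℝ) (j : ℕ) :
    p.roots.toFinset.card ≤ (Polynomial.derivative^[j] p).roots.toFinset.card + j := by
  induction j with
  | zero => simp
  | succ j ih =>
    rw [Function.iterate_succ_apply']
    have := Polynomial.card_roots_toFinset_le_derivative (Polynomial.derivative^[j] p)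
    omega

/-- A weak form of Newton's inequalities, strict because the roots are distinct. -/
theorem newton_ineq_of_distinct_roots {h : Polynomial ℝ}
    (hroots : h.natDegree ≤ h.roots.toFinset.card) {j : ℕ} (hj : j < h.natDegree) :
    (j + 2) * (h.coeff j * h.coeff (j + 2)) < (j + 1) * h.coeff (j + 1) ^ 2 := by
  set g := Polynomial.derivative^[j] h with hg
  have hle : g.natDegree ≤ h.natDegree - j := Polynomial.natDegree_iterate_derivative h j
  have hcard := card_roots_iterate_derivative h j
  rw [← hg] at hcard
  have hcard' : g.roots.toFinset.card ≤ g.natDegree :=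
    (Multiset.toFinset_card_le _).trans g.card_roots'
  -- By Rolle the j-th derivative still has as many distinct real roots as its degree; its Taylor
  -- data at 0 are the coefficients of `h` times factorials.
  have hpos := laguerre_pos_of_card_roots (g := g) (by omega) (by omega) 0
  have hg1 : g.derivative = Polynomial.derivative^[j + 1] h :=
    (Function.iterate_succ_apply' (⇑Polynomial.derivative) j h).symm
  have h0 : g.eval 0 = j.factorial * h.coeff j := by
    rw [← Polynomial.coeff_zero_eq_eval_zero, hg, Polynomial.coeff_iterate_derivative]
    rw [zero_add, Nat.descFactorial_self, nsmul_eq_mul]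
  have h1 : g.derivative.eval 0 = (j + 1).factorial * h.coeff (j + 1) := by
    rw [← Polynomial.coeff_zero_eq_eval_zero, hg1, Polynomial.coeff_iterate_derivative]
    rw [zero_add, Nat.descFactorial_self, nsmul_eq_mul]
  have h2 : g.derivative.derivative.eval 0 = (j + 2).factorial * h.coeff (j + 2) := by
    rw [← Polynomial.coeff_zero_eq_eval_zero, hg1,
      ← Function.iterate_succ_apply' (⇑Polynomial.derivative), Polynomial.coeff_iterate_derivative]
    rw [zero_add, Nat.descFactorial_self, nsmul_eq_mul]
  rw [h0, h1, h2, Nat.factorial_succ (j + 1), Nat.factorial_succ j] at hpos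
  push_cast at hpos
  have hf : (0 : ℝ) < (j.factorial : ℝ) ^ 2 * (j + 1) := by positivity
  refine lt_of_sub_pos (pos_of_mul_pos_right (?_ : 0 < (j.factorial : ℝ) ^ 2 * (j + 1) * _) hf.le)
  convert hpos using 1
  ring

theorem exists_real_of_nodes {T : Finset ℂ} (hT : ∀ t ∈ T, t ∈ realSubfield) :
    ∃ h : Polynomial ℝ, h.natDegree = T.card ∧ h.natDegree ≤ h.roots.toFinset.card ∧
      ∀ m, (∏ t ∈ T, (Polynomial.X - Polynomial.C t)).coeff m = (h.coeff m : ℂ) := by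
  classical
  have hre : ∀ t ∈ T, ((t.re : ℝ) : ℂ) = t := by
    intro t ht
    obtain ⟨r, rfl⟩ := hT t ht
    simp
  have hinj : Set.InjOn Complex.re T := by
    intro s hs t ht hst
    rw [← hre s hs, ← hre t ht, hst]
  refine ⟨∏ t ∈ T.image Complex.re, (Polynomial.X - Polynomial.C t), ?_, ?_, ?_⟩
  · simp [Finset.card_image_of_injOn hinj]
  · rw [Polynomial.roots_prod_X_sub_C, Finset.val_toFinset]
    exact (Polynomial.natDegree_finsetProd_X_sub_C_eq_card _ _).le
  · intro m
    have : ∏ t ∈ T, (Polynomial.X - Polynomial.C t) = Polynomial.map Complex.ofRealHom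
        (∏ t ∈ T.image Complex.re, (Polynomial.X - Polynomial.C t)) := by
      rw [Finset.prod_image hinj, Polynomial.map_prod]
      refine Finset.prod_congr rfl fun t ht => ?_
      simp [hre t ht]
    rw [this, Polynomial.coeff_map]
    rfl

theorem not_hasPowerRep_real_evenForm {k : ℕ} (hk : 1 ≤ k) :
    ¬ HasPowerRep realSubfield (2 * k) (evenForm k) (2 * k - 1) := by
  intro h
  obtain ⟨T, hTK, hTs, hT⟩ := exists_nodes_of_evenForm h
  obtain ⟨g, hgd, hgr, hg⟩ := exists_real_of_nodes hTK
  have hcard : k < T.card := by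
    by_contra! hle
    have := prod_X_sub_C_coeff_card T
    rw [hT _ hle (by omega)] at this
    exact zero_ne_one this
  have h1 : g.coeff (k - 1) = 0 := by
    have := hT (k - 1) (by omega) (by omega)
    rwa [hg, Complex.ofReal_eq_zero] at this
  have h2 : g.coeff (k - 1 + 1) = 0 := by
    have := hT (k - 1 + 1) (by omega) (by omega)
    rwa [hg, Complex.ofReal_eq_zero] at this
  have := newton_ineq_of_distinct_roots hgr (j := k - 1) (by omega)
  rw [h1, h2] at this
  simp at this

theorem not_hasPowerRep_real_oddForm {k : ℕ} (hk : 2 ≤ k) :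
    ¬ HasPowerRep realSubfield (2 * k - 1) (oddForm k) (2 * k - 2) := by
  intro h
  obtain ⟨T, hTK, hTs, hT⟩ := exists_nodes_of_oddForm h
  obtain ⟨g, hgd, hgr, hg⟩ := exists_real_of_nodes hTK
  have hcard := card_ge_of_oddForm_nodes hT
  obtain ⟨n, rfl⟩ := Nat.exists_eq_add_of_le' hk
  have h1 : g.coeff n = g.coeff (n + 1) := by
    have := hT n (by omega) (by omega)
    rwa [hg, hg, Complex.ofReal_inj] at this
  have h2 : g.coeff (n + 1) = g.coeff (n + 2) := by
    have := hT (n + 1) (by omega) (by omega)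
    rwa [hg, hg, Complex.ofReal_inj] at this
  -- With three equal coefficients c this reads (n + 2)c² < (n + 1)c².
  have := newton_ineq_of_distinct_roots hgr (j := n) (by omega)
  rw [h1, ← h2] at this
  nlinarith [sq_nonneg (g.coeff (n + 1))]

/-! ### Upper bounds from roots of unity -/

theorem IsPrimitiveRoot.sum_pow_mul {m : ℕ} {ω : ℂ} (hω : IsPrimitiveRoot ω m) (e : ℕ) :
    ∑ j ∈ Finset.range m, ω ^ (j * e) = if m ∣ e then (m : ℂ) else 0 := by
  simp only [mul_comm _ e, pow_mul]
  split_ifs with h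
  · simp [(hω.pow_eq_one_iff_dvd e).2 h]
  · have h1 : ω ^ e ≠ 1 := fun h' => h ((hω.pow_eq_one_iff_dvd e).1 h')
    have h2 := mul_geom_sum (ω ^ e) m
    rw [← pow_mul, mul_comm e m, pow_mul, hω.pow_eq_one, one_pow, sub_self] at h2
    exact (mul_eq_zero.1 h2).resolve_left (sub_ne_zero.2 h1)

/-- The weight ζ^j shifts the exponent to i + 1, and k + 1 divides i + 1 only for i = k when i ≤ 2k.
-/
theorem hasPowerRep_evenForm_succ {K : Subfield ℂ} {k : ℕ} {ζ : ℂ}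
    (hζ : IsPrimitiveRoot ζ (k + 1)) (hK : ζ ∈ K) :
    HasPowerRep K (2 * k) (evenForm k) (k + 1) := by
  rw [evenForm_eq, ← Finset.card_range (k + 1)]
  refine hasPowerRep_of_finset _ (fun j => ζ ^ j / ((k + 1 : ℕ) * (2 * k).choose k)) (fun _ => 1)
    (fun j => ζ ^ j) ?_ (fun _ => K.one_mem) (fun j => K.pow_mem hK j) ?_
  · exact fun j => K.div_mem (K.pow_mem hK j) (K.mul_mem (natCast_mem K _) (natCast_mem K _))
  intro i hi
  have hC : ((2 * k).choose k : ℂ) ≠ 0 := Nat.cast_ne_zero.2 (Nat.choose_pos (by omega)).ne'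
  have hk : ((k + 1 : ℕ) : ℂ) ≠ 0 := Nat.cast_ne_zero.2 (Nat.succ_ne_zero k)
  have hsum : ∑ j ∈ Finset.range (k + 1), ζ ^ j / ((k + 1 : ℕ) * (2 * k).choose k) *
      (1 : ℂ) ^ (2 * k - i) * (ζ ^ j) ^ i =
      (if k + 1 ∣ i + 1 then ((k + 1 : ℕ) : ℂ) else 0) / ((k + 1 : ℕ) * (2 * k).choose k) := by
    rw [← hζ.sum_pow_mul, Finset.sum_div]
    refine Finset.sum_congr rfl fun j _ => ?_
    rw [one_pow, mul_one, ← pow_mul]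
    ring
  have hdvd : k + 1 ∣ i + 1 ↔ i = k := by
    constructor
    · rintro ⟨c, hc⟩
      have : c < 2 := by
        by_contra! h
        nlinarith
      interval_cases c <;> omega
    · rintro rfl
      exact dvd_rfl
  rw [hsum]
  simp only [hdvd]
  split_ifs with h
  · subst h
    field_simp
  · simp

/-- The unweighted sum keeps i = 0, k, 2k; two more powers cancel x^(2k) and y^(2k). -/
theorem hasPowerRep_evenForm_add_two {K : Subfield ℂ} {k : ℕ} (hk1 : 1 ≤ k) {ξ : ℂ}
    (hξ : IsPrimitiveRoot ξ k) (hK : ξ ∈ K) :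
    HasPowerRep K (2 * k) (evenForm k) (k + 2) := by
  set c : ℂ := ((2 * k).choose k : ℂ) with hc
  have hC : c ≠ 0 := Nat.cast_ne_zero.2 (Nat.choose_pos (by omega)).ne'
  have hk : (k : ℂ) ≠ 0 := Nat.cast_ne_zero.2 (by omega)
  have hcK : 1 / c ∈ K := K.div_mem K.one_mem (natCast_mem K _)
  have hmain : HasPowerRep K (2 * k) (binaryForm (2 * k) (fun i =>
      ((if i = k then 1 else 0) + (if i = 0 then 1 / c else 0)) +
        (if i = 2 * k then 1 / c else 0))) (Finset.range k).card := by
    refine hasPowerRep_of_finset _ (fun j => 1 / (k * c)) (fun _ => 1)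
      (fun j => ξ ^ j) ?_ (fun _ => K.one_mem) (fun j => K.pow_mem hK j) ?_
    · exact fun j => K.div_mem K.one_mem (K.mul_mem (natCast_mem K _) (natCast_mem K _))
    intro i hi
    have hsum : ∑ j ∈ Finset.range k, 1 / (k * c) * (1 : ℂ) ^ (2 * k - i) * (ξ ^ j) ^ i =
        (if k ∣ i then (k : ℂ) else 0) / (k * c) := by
      rw [← hξ.sum_pow_mul, Finset.sum_div]
      refine Finset.sum_congr rfl fun j _ => ?_
      rw [one_pow, mul_one, ← pow_mul]
      ring
    have hdvd : k ∣ i ↔ i = 0 ∨ i = k ∨ i = 2 * k := by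
      constructor
      · rintro ⟨c, hc⟩
        have : c < 3 := by
          by_contra! h
          nlinarith
        interval_cases c <;> omega
      · rintro (rfl | rfl | rfl) <;> simp
    rw [hsum]
    simp only [hdvd]
    by_cases h0 : i = 0
    · subst h0
      simp [show ¬ 0 = k by omega, show ¬ k = 0 by omega]
      field_simp
    by_cases h1 : i = k
    · subst h1
      simp [h0, ← hc, show ¬ i = 2 * i by omega]
      field_simp
    by_cases h2 : i = 2 * k
    · subst h2
      simp [show ¬ k = 0 by omega, show ¬ 2 * k = k by omega]
      field_simp
    · simp [h0, h1, h2]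
  have h2 := (hmain.add_pow (K.neg_mem hcK) K.one_mem K.zero_mem).add_pow (K.neg_mem hcK)
    K.zero_mem K.one_mem
  rw [Finset.card_range] at h2
  convert h2 using 1
  rw [evenForm_eq, ← binaryForm_add, ← binaryForm_add, binaryForm_single (i := 0) (by omega),
    binaryForm_single (i := 2 * k) le_rfl]
  simp
  ring

theorem hasPowerRep_oddForm_self {K : Subfield ℂ} {k : ℕ} (hk1 : 1 ≤ k) {ζ : ℂ}
    (hζ : IsPrimitiveRoot ζ (k + 1)) (hK : ζ ∈ K) :
    HasPowerRep K (2 * k - 1) (oddForm k) k := by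
  suffices h : HasPowerRep K (2 * k - 1) (oddForm k) ((Finset.range (k + 1)).erase 0).card by
    simpa using h
  rw [oddForm_eq_choose_mul hk1]
  set c : ℂ := ((2 * k - 1).choose k : ℂ) with hc
  refine hasPowerRep_of_finset _ (fun j => (ζ ^ (2 * j) - ζ ^ j) / ((k + 1 : ℕ) * c)) (fun _ => 1)
    (fun j => ζ ^ j) ?_ (fun _ => K.one_mem) (fun j => K.pow_mem hK j) ?_
  · exact fun j => K.div_mem (K.sub_mem (K.pow_mem hK _) (K.pow_mem hK _))
      (K.mul_mem (natCast_mem K _) (natCast_mem K _))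
  intro i hi
  have hk : ((k + 1 : ℕ) : ℂ) ≠ 0 := Nat.cast_ne_zero.2 (Nat.succ_ne_zero k)
  -- The weight ζ^(2j) - ζ^j vanishes at j = 0, which saves one summand; its two terms pick out i =
  -- k - 1 and i = k.
  rw [Finset.sum_erase _ (by simp)]
  have hsum : ∑ j ∈ Finset.range (k + 1), (ζ ^ (2 * j) - ζ ^ j) / ((k + 1 : ℕ) * c) *
      (1 : ℂ) ^ (2 * k - 1 - i) * (ζ ^ j) ^ i =
      ((if k + 1 ∣ i + 2 then ((k + 1 : ℕ) : ℂ) else 0) -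
        (if k + 1 ∣ i + 1 then ((k + 1 : ℕ) : ℂ) else 0)) / ((k + 1 : ℕ) * c) := by
    rw [← hζ.sum_pow_mul, ← hζ.sum_pow_mul, ← Finset.sum_sub_distrib, Finset.sum_div]
    refine Finset.sum_congr rfl fun j _ => ?_
    rw [one_pow, mul_one, ← pow_mul]
    ring
  have hdvd1 : k + 1 ∣ i + 1 ↔ i = k := by
    constructor
    · rintro ⟨c, hc⟩
      have : c < 2 := by
        by_contra! h
        have : (k + 1) * 2 ≤ (k + 1) * c := Nat.mul_le_mul_left _ h
        omega
      interval_cases c <;> omega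
    · rintro rfl
      exact dvd_rfl
  have hdvd2 : k + 1 ∣ i + 2 ↔ i = k - 1 := by
    constructor
    · rintro ⟨c, hc⟩
      have : c < 2 := by
        by_contra! h
        have : (k + 1) * 2 ≤ (k + 1) * c := Nat.mul_le_mul_left _ h
        omega
      interval_cases c <;> omega
    · rintro rfl
      exact ⟨1, by omega⟩
  rw [hsum]
  simp only [hdvd1, hdvd2]
  congr 1
  split_ifs <;> field_simp <;> ring

theorem hasPowerRep_oddForm_succ {K : Subfield ℂ} {k : ℕ} (hk1 : 2 ≤ k) {ξ : ℂ}
    (hξ : IsPrimitiveRoot ξ k) (hK : ξ ∈ K) :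
    HasPowerRep K (2 * k - 1) (oddForm k) (k + 1) := by
  set c : ℂ := ((2 * k - 1).choose k : ℂ) with hc
  have hC : c ≠ 0 := Nat.cast_ne_zero.2 (Nat.choose_pos (by omega)).ne'
  have hk : (k : ℂ) ≠ 0 := Nat.cast_ne_zero.2 (by omega)
  have hcK : 1 / c ∈ K := K.div_mem K.one_mem (natCast_mem K _)
  have hmain : HasPowerRep K (2 * k - 1) (binaryForm (2 * k - 1) (fun i =>
      (((if i = k - 1 then 1 else 0) + (if i = k then -1 else 0)) +
        (if i = 0 then -(1 / c) else 0)) + (if i = 2 * k - 1 then 1 / c else 0)))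
      ((Finset.range k).erase 0).card := by
    refine hasPowerRep_of_finset _ (fun j => (ξ ^ j - 1) / (k * c)) (fun _ => 1)
      (fun j => ξ ^ j) ?_ (fun _ => K.one_mem) (fun j => K.pow_mem hK j) ?_
    · exact fun j => K.div_mem (K.sub_mem (K.pow_mem hK _) K.one_mem)
        (K.mul_mem (natCast_mem K _) (natCast_mem K _))
    intro i hi
    -- Again the weight ξ^j - 1 vanishes at j = 0: k - 1 summands, plus two to correct i = 0 and i =
    -- 2k - 1.
    rw [Finset.sum_erase _ (by simp)]
    have hsum : ∑ j ∈ Finset.range k, (ξ ^ j - 1) / (k * c) * (1 : ℂ) ^ (2 * k - 1 - i) *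
        (ξ ^ j) ^ i = ((if k ∣ i + 1 then (k : ℂ) else 0) -
          (if k ∣ i then (k : ℂ) else 0)) / (k * c) := by
      rw [← hξ.sum_pow_mul, ← hξ.sum_pow_mul, ← Finset.sum_sub_distrib, Finset.sum_div]
      refine Finset.sum_congr rfl fun j _ => ?_
      rw [one_pow, mul_one, ← pow_mul]
      ring
    have hdvd1 : k ∣ i ↔ i = 0 ∨ i = k := by
      constructor
      · rintro ⟨c, hc⟩
        have : c < 2 := by
          by_contra! h
          have : k * 2 ≤ k * c := Nat.mul_le_mul_left _ h
          omega
        interval_cases c <;> omega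
      · rintro (rfl | rfl) <;> simp
    have hdvd2 : k ∣ i + 1 ↔ i = k - 1 ∨ i = 2 * k - 1 := by
      constructor
      · rintro ⟨c, hc⟩
        have : c < 3 := by
          by_contra! h
          have : k * 3 ≤ k * c := Nat.mul_le_mul_left _ h
          omega
        interval_cases c <;> omega
      · rintro (rfl | rfl)
        · exact ⟨1, by omega⟩
        · exact ⟨2, by omega⟩
    rw [hsum]
    simp only [hdvd1, hdvd2]
    by_cases h0 : i = 0
    · subst h0
      simp [show ¬ 0 = k by omega, show ¬ 0 = k - 1 by omega,
        show ¬ 0 = 2 * k - 1 by omega]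
      field_simp
    by_cases h1 : i = k
    · subst h1
      simp [h0, ← hc, show ¬ i = 2 * i - 1 by omega, show ¬ i = i - 1 by omega]
      field_simp
    by_cases h2 : i = k - 1
    · subst h2
      simp [h0, h1, choose_pred_eq (show 1 ≤ k by omega), ← hc,
        show ¬ k - 1 = 2 * k - 1 by omega]
      field_simp
    by_cases h3 : i = 2 * k - 1
    · subst h3
      simp [h0, h1, h2]
      field_simp
    · simp [h0, h1, h2, h3]
  have h2 := (hmain.add_pow hcK K.one_mem K.zero_mem).add_pow (K.neg_mem hcK)
    K.zero_mem K.one_mem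
  rw [Finset.card_erase_of_mem (by simp; omega), Finset.card_range,
    show k - 1 + 1 + 1 = k + 1 by omega] at h2
  convert h2 using 1
  rw [oddForm_eq (by omega), ← binaryForm_add _ _ (fun i => if i = 2 * k - 1 then 1 / c else 0),
    ← binaryForm_add _ _ (fun i => if i = 0 then -(1 / c) else 0),
    binaryForm_single (i := 0) (by omega), binaryForm_single (i := 2 * k - 1) le_rfl]
  simp
  ring

/-! ### Upper bounds by the degree, with rational nodes -/

/-- Sylvester's criterion, sufficiency, for `d` finite nodes in degree `d`. -/
theorem exists_weights_of_apolar {F : Type*} [Field F] (T : Finset F) (a : ℕ → F)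
    (h : ∑ i ∈ Finset.range (T.card + 1),
      (∏ t ∈ T, (Polynomial.X - Polynomial.C t)).coeff i * a i = 0) :
    ∃ lam : F → F, ∀ i ≤ T.card, a i = ∑ t ∈ T, lam t * t ^ i := by
  classical
  -- The functional X^i ↦ a i. Lagrange interpolation writes it as a quadrature on `T` below degree
  -- `T.card`; apolarity, `A g = 0`, extends this to degree `T.card`.
  let A : Polynomial F →ₗ[F] F :=
    ∑ i ∈ Finset.range (T.card + 1), (Polynomial.lcoeff F i).smulRight (a i)
  have hA : ∀ q, A q = ∑ i ∈ Finset.range (T.card + 1), q.coeff i * a i := by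
    intro q
    simp [A]
  have hmon : ∀ i ≤ T.card, A (Polynomial.X ^ i) = a i := by
    intro i hi
    rw [hA, Finset.sum_eq_single i]
    · simp
    · intro j _ hj
      simp [Polynomial.coeff_X_pow, hj]
    · intro hi'
      exact absurd (Finset.mem_range.2 (Nat.lt_succ_of_le hi)) hi'
  have hlow : ∀ q : Polynomial F, q.degree < (T.card : WithBot ℕ) →
      A q = ∑ t ∈ T, A (Lagrange.basis T id t) * q.eval t := by
    intro q hq
    conv_lhs => rw [Lagrange.eq_interpolate (s := T) (v := id) (fun _ _ _ _ h => h) hq]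
    rw [Lagrange.interpolate_apply, map_sum]
    refine Finset.sum_congr rfl fun t _ => ?_
    rw [← Polynomial.smul_eq_C_mul, map_smul, smul_eq_mul, mul_comm, id]
  refine ⟨fun t => A (Lagrange.basis T id t), fun i hi => ?_⟩
  set g : Polynomial F := ∏ t ∈ T, (Polynomial.X - Polynomial.C t) with hg
  have hgm : g.Monic := Polynomial.monic_prod_of_monic _ _ fun t _ => Polynomial.monic_X_sub_C t
  have hgd : g.degree = T.card := by
    rw [Polynomial.degree_eq_natDegree hgm.ne_zero, hg,
      Polynomial.natDegree_finsetProd_X_sub_C_eq_card]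
  rcases hi.lt_or_eq with hi | hi
  · rw [← hmon i hi.le, hlow _ (by simpa using hi)]
    simp
  · have hAg : A g = 0 := by rw [hA, h]
    have hlt : (Polynomial.X ^ i - g).degree < (T.card : WithBot ℕ) := by
      rw [← hgd, ← neg_sub, Polynomial.degree_neg]
      refine Polynomial.degree_sub_lt_left ?_ hgm.ne_zero (by simp [hgm.leadingCoeff])
      rw [hgd, Polynomial.degree_X_pow, hi]
    rw [← hmon i hi.le, ← sub_zero (A _), ← hAg, ← map_sub, hlow _ hlt]
    refine Finset.sum_congr rfl fun t ht => ?_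
    have : g.eval t = 0 := by
      rw [hg, Polynomial.eval_prod]
      exact Finset.prod_eq_zero ht (by simp)
    simp [this]

theorem hasPowerRep_of_apolar {K : Subfield ℂ} (T : Finset ℚ) (a : ℕ → ℚ)
    (h : ∑ i ∈ Finset.range (T.card + 1),
      (∏ t ∈ T, (Polynomial.X - Polynomial.C t)).coeff i * a i = 0) :
    HasPowerRep K T.card
      (binaryForm T.card (fun i => (T.card.choose i : ℂ) * (a i : ℂ))) T.card := by
  obtain ⟨lam, hlam⟩ := exists_weights_of_apolar T a h
  refine hasPowerRep_of_finset T (fun t => (lam t : ℂ)) (fun _ => 1) (fun t => (t : ℂ))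
    (fun t => SubfieldClass.ratCast_mem K _) (fun _ => K.one_mem) (fun t => SubfieldClass.ratCast_mem K _) fun i hi => ?_
  rw [hlam i hi]
  push_cast
  simp

/-- The nodes `-2^n`, `|n| < k`. -/
noncomputable def symmetricNodes (k : ℕ) : Finset ℚ :=
  (Finset.Ioo (-k : ℤ) k).image fun n => -(2 : ℚ) ^ n

theorem neg_two_zpow_injective : Function.Injective fun n : ℤ => -(2 : ℚ) ^ n := fun m n h =>
  zpow_right_injective₀ (by norm_num : (0 : ℚ) < 2) (by norm_num) (neg_injective h)

theorem card_symmetricNodes (k : ℕ) : (symmetricNodes k).card = 2 * k - 1 := by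
  rw [symmetricNodes, Finset.card_image_of_injective _ neg_two_zpow_injective, Int.card_Ioo]
  omega

theorem one_notMem_symmetricNodes (k : ℕ) : (1 : ℚ) ∉ symmetricNodes k := by
  simp only [symmetricNodes, Finset.mem_image, not_exists, not_and]
  intro n _ h
  have : (0 : ℚ) < 2 ^ n := by positivity
  linarith

theorem Polynomial.reverse_one (F : Type*) [Field F] : (1 : Polynomial F).reverse = 1 := by
  rw [← Polynomial.C_1, Polynomial.reverse_C]

theorem reverse_X_sub_C {F : Type*} [Field F] {t : F} (ht : t ≠ 0) :
    (Polynomial.X - Polynomial.C t).reverse =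
      Polynomial.C (-t) * (Polynomial.X - Polynomial.C t⁻¹) := by
  have hX : (Polynomial.X : Polynomial F).reverse = 1 := by
    rw [← mul_one Polynomial.X, Polynomial.reverse_X_mul, Polynomial.reverse_one]
  have hC : Polynomial.C t * Polynomial.C t⁻¹ = 1 := by
    rw [← Polynomial.C_mul, mul_inv_cancel₀ ht, Polynomial.C_1]
  rw [sub_eq_add_neg, ← Polynomial.C_neg, Polynomial.reverse_add_C, hX, Polynomial.natDegree_X,
    pow_one, Polynomial.C_neg]
  linear_combination -hC

theorem reverse_prod_of_domain {F : Type*} [Field F] {ι : Type*} (s : Finset ι)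
    (f : ι → Polynomial F) : (∏ i ∈ s, f i).reverse = ∏ i ∈ s, (f i).reverse := by
  classical
  induction s using Finset.induction_on with
  | empty => simp [Polynomial.reverse_one]
  | insert a s ha ih => rw [Finset.prod_insert ha, Finset.prod_insert ha,
      Polynomial.reverse_mul_of_domain, ih]

/-- The nodes are closed under inversion. Their negative sign matters: the factors -t are then
positive with product 1, making the polynomial palindromic rather than antipalindromic. -/
theorem reverse_prod_symmetricNodes (k : ℕ) :
    (∏ t ∈ symmetricNodes k, (Polynomial.X - Polynomial.C t)).reverse =
      ∏ t ∈ symmetricNodes k, (Polynomial.X - Polynomial.C t) := by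
  have hpos : ∀ n : ℤ, (2 : ℚ) ^ n ≠ 0 := fun n => by positivity
  rw [reverse_prod_of_domain, symmetricNodes,
    Finset.prod_image neg_two_zpow_injective.injOn, Finset.prod_image neg_two_zpow_injective.injOn,
    Finset.prod_congr rfl fun n _ => reverse_X_sub_C (neg_ne_zero.2 (hpos n)),
    Finset.prod_mul_distrib]
  have h1 : ∏ n ∈ Finset.Ioo (-k : ℤ) k, Polynomial.C (-(-(2 : ℚ) ^ n)) = 1 := by
    refine Finset.prod_involution (fun n _ => -n) ?_ ?_ ?_ ?_
    · intro n _
      rw [neg_neg, neg_neg, ← Polynomial.C_mul, zpow_neg, mul_inv_cancel₀ (hpos n),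
        Polynomial.C_1]
    · intro n _ hn h0
      have : n = 0 := by omega
      simp [this] at hn
    · intro n hn
      simp only [Finset.mem_Ioo] at hn ⊢
      omega
    · intro n _
      exact neg_neg n
  rw [h1, one_mul]
  refine Finset.prod_nbij' (fun n => -n) (fun n => -n) ?_ ?_ ?_ ?_ ?_
  · intro n hn
    simp only [Finset.mem_Ioo] at hn ⊢
    omega
  · intro n hn
    simp only [Finset.mem_Ioo] at hn ⊢
    omega
  · intro n _
    exact neg_neg n
  · intro n _
    exact neg_neg n
  · intro n _
    rw [zpow_neg, inv_neg]

theorem coeff_prod_symmetricNodes {k : ℕ} (hk : 1 ≤ k) :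
    (∏ t ∈ symmetricNodes k, (Polynomial.X - Polynomial.C t)).coeff (k - 1) =
      (∏ t ∈ symmetricNodes k, (Polynomial.X - Polynomial.C t)).coeff k := by
  conv_lhs => rw [← reverse_prod_symmetricNodes, Polynomial.coeff_reverse,
    Polynomial.natDegree_finsetProd_X_sub_C_eq_card, card_symmetricNodes,
    Polynomial.revAt_le (by omega)]
  congr 1
  omega

theorem hasPowerRep_oddForm_degree (K : Subfield ℂ) {k : ℕ} (hk : 1 ≤ k) :
    HasPowerRep K (2 * k - 1) (oddForm k) (2 * k - 1) := by
  have h := hasPowerRep_of_apolar (K := K) (symmetricNodes k)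
    (fun i => (if i = k - 1 then 1 / ((2 * k - 1).choose k : ℚ) else 0) +
      (if i = k then -1 / ((2 * k - 1).choose k : ℚ) else 0)) (by
      simp only [mul_add, mul_ite, mul_zero, Finset.sum_add_distrib, Finset.sum_ite_eq',
        Finset.mem_range, card_symmetricNodes]
      rw [if_pos (by omega), if_pos (by omega), coeff_prod_symmetricNodes hk]
      ring)
  rw [card_symmetricNodes] at h
  rw [oddForm_eq_choose_mul hk]
  convert h using 5
  push_cast [apply_ite (Rat.cast : ℚ → ℂ)]
  rfl

theorem hasPowerRep_evenForm_degree (K : Subfield ℂ) {k : ℕ} (hk : 1 ≤ k) :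
    HasPowerRep K (2 * k) (evenForm k) (2 * k) := by
  have hcard : (Finset.cons 1 _ (one_notMem_symmetricNodes k)).card = 2 * k := by
    rw [Finset.card_cons, card_symmetricNodes]
    omega
  -- Multiplying the palindromic q by X - 1 gives middle coefficient q_(k-1) - q_k = 0.
  have h := hasPowerRep_of_apolar (K := K) (Finset.cons 1 _ (one_notMem_symmetricNodes k))
    (fun i => if i = k then 1 / ((2 * k).choose k : ℚ) else 0) (by
      simp only [mul_ite, mul_zero, Finset.sum_ite_eq', Finset.mem_range, hcard]
      rw [if_pos (by omega), Finset.prod_cons, sub_mul, Polynomial.C_1, one_mul,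
        Polynomial.coeff_sub]
      obtain ⟨n, rfl⟩ := Nat.exists_eq_add_of_le' hk
      rw [Polynomial.coeff_X_mul, ← coeff_prod_symmetricNodes hk]
      simp)
  rw [hcard] at h
  rw [evenForm_eq_choose_mul]
  convert h using 5
  push_cast [apply_ite (Rat.cast : ℚ → ℂ)]
  rfl

/-! ### Coefficients, homogeneity and conclusion -/

theorem coeff_oddForm_mem (K : Subfield ℂ) (k : ℕ) (m : Fin 2 →₀ ℕ) :
    (oddForm k).coeff m ∈ K := by
  have : oddForm k = MvPolynomial.map (Int.castRingHom ℂ)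
      (X 0 ^ (k - 1) * X 1 ^ (k - 1) * (X 0 - X 1)) := by
    simp [oddForm]
  rw [this, coeff_map]
  exact intCast_mem K _

theorem coeff_evenForm_mem (K : Subfield ℂ) (k : ℕ) (m : Fin 2 →₀ ℕ) :
    (evenForm k).coeff m ∈ K := by
  have : evenForm k = MvPolynomial.map (Int.castRingHom ℂ) (X 0 ^ k * X 1 ^ k) := by
    simp [evenForm]
  rw [this, coeff_map]
  exact intCast_mem K _

theorem isHomogeneous_oddForm {k : ℕ} (hk : 1 ≤ k) : (oddForm k).IsHomogeneous (2 * k - 1) := by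
  have := (((isHomogeneous_X ℂ (0 : Fin 2)).pow (k - 1)).mul
    ((isHomogeneous_X ℂ (1 : Fin 2)).pow (k - 1))).mul
      ((isHomogeneous_X ℂ (0 : Fin 2)).sub (isHomogeneous_X ℂ (1 : Fin 2)))
  rw [oddForm]
  convert this using 1
  omega

theorem isHomogeneous_evenForm (k : ℕ) : (evenForm k).IsHomogeneous (2 * k) := by
  have := ((isHomogeneous_X ℂ (0 : Fin 2)).pow k).mul ((isHomogeneous_X ℂ (1 : Fin 2)).pow k)
  rw [evenForm]
  convert this using 1
  omega

theorem relRanks_explicit {k : ℕ} (hk : 3 ≤ k) {ζ ξ : ℂ} (hζ : IsPrimitiveRoot ζ (k + 1))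
    (hξ : IsPrimitiveRoot ξ k) :
    (IsRelRank ℚ⟮ζ⟯.toSubfield (2 * k - 1) (oddForm k) k ∧
        IsRelRank ℚ⟮ξ⟯.toSubfield (2 * k - 1) (oddForm k) (k + 1) ∧
        IsRelRank realSubfield (2 * k - 1) (oddForm k) (2 * k - 1)) ∧
      (IsRelRank ℚ⟮ζ⟯.toSubfield (2 * k) (evenForm k) (k + 1) ∧
        IsRelRank ℚ⟮ξ⟯.toSubfield (2 * k) (evenForm k) (k + 2) ∧
        IsRelRank realSubfield (2 * k) (evenForm k) (2 * k)) := by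
  have hζK : ζ ∈ ℚ⟮ζ⟯.toSubfield := IntermediateField.mem_adjoin_simple_self ℚ ζ
  have hξK : ξ ∈ ℚ⟮ξ⟯.toSubfield := IntermediateField.mem_adjoin_simple_self ℚ ξ
  have hnot : ζ ∉ ℚ⟮ξ⟯.toSubfield :=
    primitiveRoot_notMem_adjoin (by omega) (by omega) (by simp) hζ hξ
  refine ⟨⟨?_, ?_, ?_⟩, ?_, ?_, ?_⟩
  · have h := hasPowerRep_oddForm_self (by omega) hζ hζK
    obtain ⟨n, rfl⟩ : ∃ n, k = n + 1 := ⟨k - 1, by omega⟩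
    exact isRelRank_of_not h (not_hasPowerRep_oddForm_pred (by omega))
  · exact isRelRank_of_not (hasPowerRep_oddForm_succ (by omega) hξ hξK)
      fun h => hnot (mem_of_hasPowerRep_oddForm hζ.pow_eq_one h)
  · have h := isRelRank_of_not (r := 2 * k - 2) (K := realSubfield) (d := 2 * k - 1)
      (f := oddForm k)
    rw [show 2 * k - 2 + 1 = 2 * k - 1 by omega] at h
    exact h (hasPowerRep_oddForm_degree _ (by omega)) (not_hasPowerRep_real_oddForm (by omega))
  · exact isRelRank_of_not (hasPowerRep_evenForm_succ hζ hζK) not_hasPowerRep_evenForm_self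
  · exact isRelRank_of_not (hasPowerRep_evenForm_add_two (by omega) hξ hξK)
      fun h => hnot (mem_of_hasPowerRep_evenForm (by omega) hζ.pow_eq_one h)
  · have h := isRelRank_of_not (r := 2 * k - 1) (K := realSubfield) (d := 2 * k)
      (f := evenForm k)
    rw [show 2 * k - 1 + 1 = 2 * k by omega] at h
    exact h (hasPowerRep_evenForm_degree _ (by omega)) (not_hasPowerRep_real_evenForm (by omega))

theorem three_le_encard {S : Set ℕ} {a b c : ℕ} (ha : a ∈ S) (hb : b ∈ S) (hc : c ∈ S)
    (hab : a < b) (hbc : b < c) : 3 ≤ S.encard := by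
  rw [← Set.encard_eq_three.2 ⟨a, b, c, hab.ne, (hab.trans hbc).ne, hbc.ne, rfl⟩]
  refine Set.encard_le_encard ?_
  rintro x (rfl | rfl | rfl) <;> assumption

theorem theorem3p1 :
    (∀ d : ℕ, 5 ≤ d → ∃ p : MvPolynomial (Fin 2) ℂ,
      p.IsHomogeneous d ∧ 3 ≤ (relRanks d p).encard) ∧
    (∀ k : ℕ, 3 ≤ k → ∀ ζ ξ : ℂ, IsPrimitiveRoot ζ (k + 1) → IsPrimitiveRoot ξ k →
      (IsRelRank ℚ⟮ζ⟯.toSubfield (2 * k - 1) (oddForm k) k ∧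
        IsRelRank ℚ⟮ξ⟯.toSubfield (2 * k - 1) (oddForm k) (k + 1) ∧
        IsRelRank realSubfield (2 * k - 1) (oddForm k) (2 * k - 1)) ∧
      (IsRelRank ℚ⟮ζ⟯.toSubfield (2 * k) (evenForm k) (k + 1) ∧
        IsRelRank ℚ⟮ξ⟯.toSubfield (2 * k) (evenForm k) (k + 2) ∧
        IsRelRank realSubfield (2 * k) (evenForm k) (2 * k))) := by
  refine ⟨fun d hd => ?_, fun k hk ζ ξ hζ hξ => relRanks_explicit hk hζ hξ⟩
  obtain ⟨k, hk, hdk⟩ : ∃ k, 3 ≤ k ∧ (d = 2 * k - 1 ∨ d = 2 * k) :=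
    ⟨(d + 1) / 2, by omega, by omega⟩
  obtain ⟨⟨h1, h2, h3⟩, h4, h5, h6⟩ := relRanks_explicit hk
    (Complex.isPrimitiveRoot_exp (k + 1) (by omega)) (Complex.isPrimitiveRoot_exp k (by omega))
  -- For k ≥ 3 both k < k + 1 < 2k - 1 and k + 1 < k + 2 < 2k hold.
  rcases hdk with rfl | rfl
  · exact ⟨oddForm k, isHomogeneous_oddForm (by omega),
      three_le_encard ⟨_, coeff_oddForm_mem _ k, h1⟩ ⟨_, coeff_oddForm_mem _ k, h2⟩
        ⟨_, coeff_oddForm_mem _ k, h3⟩ (by omega) (by omega)⟩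
  · exact ⟨evenForm k, isHomogeneous_evenForm k,
      three_le_encard ⟨_, coeff_evenForm_mem _ k, h4⟩ ⟨_, coeff_evenForm_mem _ k, h5⟩
        ⟨_, coeff_evenForm_mem _ k, h6⟩ (by omega) (by omega)⟩
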